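/- Consider a distributed storage network with $n\ge 2$ nodes in which at each time one node fails and is replaced by a newcomer that stores an amount $\alpha\ge 0$ and receives an amount $\beta\ge 0$ from each of $d$ helpers, $1\le d\le n-1$, chosen among the other $n-1$ nodes. A dynamic helper selection (DHS) scheme $A$ prescribes, for each time $\tau$, the set of $d$ helpers as a function of the nodes $F_1,\dots,F_\tau$ that have failed so far. For each finite failure pattern $F_1,\dots,F_T$ ($T\ge 0$), the scheme $A$ generates an information flow graph $G$. It has a source $s$; each storage node $x$ (an initial node or a newcomer) is represented by an edge $x_{\mathrm{in}}\to x_{\mathrm{out}}$ of capacity $\alpha$; $s$ is joined to $x_{\mathrm{in}}$ by an edge of infinite capacity for each of the $n$ initial nodes $x$; for each newcomer $y$ and each of its $d$ helpers $x$ (the storage nodes active at that time) there is an edge $x_{\mathrm{out}}\to y_{\mathrm{in}}$ of capacity $\beta$; and for each choice of $k$ of the $n$ storage nodes active after time $T$ there is a data collector $t\in \mathrm{DC}(G)$, joined to their out-vertices by edges of infinite capacity into $t$. Let $\mathcal G_A$ be the set of all these graphs, and let $\mathrm{mincut}_G(s,t)$ be the minimum capacity of a cut separating $s$ from $t$ in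 $G$. The family helper selection (FHS) scheme $F$ is the following: sort the nodes arbitrarily as $1,\dots,n$; the first $n-d$ nodes form the first complete family, the next $n-d$ nodes the second, and so on, up to $\lfloor n/(n-d)\rfloor$ complete families, and the remaining $n \bmod (n-d)$ nodes form an incomplete family; a failed node of a complete family is always helped by all nodes outside its family, and a failed node of the incomplete family by the nodes $1,\dots,d$. **Proposition.** Let $k=n-1$, $\alpha=d\beta$ and $n \bmod (n-d)=0$. Then, for every sorting of the nodes in the FHS scheme $F$ and every DHS scheme $A$, the minima below are attained and $$\min_{G\in\mathcal G_F}\ \min_{t\in \mathrm{DC}(G)}\mathrm{mincut}_G(s,t)=\frac{n\alpha}{2}\ \ge\ \min_{G\in\mathcal G_A}\ \min_{t\in \mathrm{DC}(G)}\mathrm{mincut}_G(s,t).$$ That is, at $\alpha=d\beta$ no DHS scheme has a larger min-cut than the FHS scheme. -/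

import Mathlib

open scoped NNReal ENNReal

/-- A dynamic helper selection (DHS) scheme for `n` nodes with `d` helpers per repair.
Times are counted from `0`: `helpers τ F` is the helper set used by the newcomer at time `τ` when the
nodes that failed at the times `0, …, τ` are `F 0, …, F τ`. -/
structure DHS (n d : ℕ) where
  helpers : (τ : ℕ) → (Fin (τ + 1) → Fin n) → Finset (Fin n)
  card_helpers : ∀ τ F, (helpers τ F).card = d
  failed_notMem : ∀ τ F, F (Fin.last τ) ∉ helpers τ F

/-- A stationary helper selection (SHS) scheme: a fixed set of `d` helpers for every node. -/
structure SHS (n d : ℕ) where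
  helpers : Fin n → Finset (Fin n)
  card_helpers : ∀ i, (helpers i).card = d
  self_notMem : ∀ i, i ∉ helpers i

/-- Every SHS scheme is a DHS scheme. -/
def SHS.toDHS {n d : ℕ} (A : SHS n d) : DHS n d where
  helpers τ F := A.helpers (F (Fin.last τ))
  card_helpers _ _ := A.card_helpers _
  failed_notMem _ _ := A.self_notMem _

/-! ### The family helper selection scheme -/

/-- The helper set of node `i` in the FHS scheme when the nodes are sorted by `σ`, i.e. node `i` has
position `σ i ∈ {0, …, n - 1}`. The family of the node at position `p` is `p / (n - d)`; the families
`0, …, n / (n - d) - 1` are complete, and the remaining `n % (n - d)` nodes form the incomplete one.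
A node in a complete family is helped by all nodes outside its family, a node in the incomplete
family by the first `d` nodes. -/
def fhsHelpers (n d : ℕ) (σ : Equiv.Perm (Fin n)) (i : Fin n) : Finset (Fin n) :=
  if (σ i : ℕ) / (n - d) < n / (n - d) then
    Finset.univ.filter fun j => (σ j : ℕ) / (n - d) ≠ (σ i : ℕ) / (n - d)
  else
    Finset.univ.filter fun j => (σ j : ℕ) < d

theorem card_filter_perm {n : ℕ} (σ : Equiv.Perm (Fin n)) (p : ℕ → Prop) [DecidablePred p] :
    (Finset.univ.filter fun j : Fin n => p (σ j)).card = ((Finset.range n).filter p).card := by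
  refine Finset.card_bij (fun j _ => (σ j : ℕ)) ?_ ?_ ?_
  · intro j hj
    simpa using hj
  · intro a _ b _ h
    exact σ.injective (Fin.ext h)
  · intro b hb
    simp only [Finset.mem_filter, Finset.mem_range] at hb
    exact ⟨σ.symm ⟨b, hb.1⟩, by simpa using hb.2, by simp⟩

theorem card_fhsHelpers {n d : ℕ} (hd : d < n) (σ : Equiv.Perm (Fin n)) (i : Fin n) :
    (fhsHelpers n d σ i).card = d := by
  unfold fhsHelpers
  have hm : 0 < n - d := Nat.sub_pos_of_lt hd
  split_ifs with h
  · set q := (σ i : ℕ) / (n - d) with hq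
    rw [card_filter_perm σ (fun p => p / (n - d) ≠ q)]
    have hle : (q + 1) * (n - d) ≤ n :=
      (Nat.mul_le_mul_right _ h).trans (Nat.div_mul_le_self n (n - d))
    have hfam : (Finset.range n).filter (fun p => p / (n - d) = q)
        = Finset.Ico (q * (n - d)) ((q + 1) * (n - d)) := by
      ext p
      simp only [Finset.mem_filter, Finset.mem_range, Finset.mem_Ico]
      rw [show p / (n - d) = q ↔ q * (n - d) ≤ p ∧ p < (q + 1) * (n - d) by
        rw [← Nat.le_div_iff_mul_le hm, ← Nat.div_lt_iff_lt_mul hm]; omega]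
      constructor
      · exact fun h => h.2
      · exact fun h => ⟨h.2.trans_le hle, h⟩
    have hsum := Finset.card_filter_add_card_filter_not
      (s := Finset.range n) (fun p => p / (n - d) = q)
    rw [hfam, Nat.card_Ico, Finset.card_range, add_mul, one_mul, Nat.add_sub_cancel_left] at hsum
    simp only [ne_eq]
    omega
  · rw [card_filter_perm σ (fun p => p < d)]
    have : (Finset.range n).filter (fun p => p < d) = Finset.range d := by
      ext p
      simp only [Finset.mem_filter, Finset.mem_range]
      omega
    rw [this, Finset.card_range]

theorem self_notMem_fhsHelpers {n d : ℕ} (hd : d < n) (σ : Equiv.Perm (Fin n)) (i : Fin n) :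
    i ∉ fhsHelpers n d σ i := by
  unfold fhsHelpers
  have hm : 0 < n - d := Nat.sub_pos_of_lt hd
  split_ifs with h
  · simp
  · simp only [Finset.mem_filter, Finset.mem_univ, true_and, not_lt] at h ⊢
    have h1 := (Nat.le_div_iff_mul_le hm).mp h
    have h2 := Nat.div_add_mod n (n - d)
    have h3 := Nat.mod_lt n hm
    rw [mul_comm] at h2
    omega

/-- The family helper selection (FHS) scheme for the sorting `σ` of the nodes. -/
def fhs {n d : ℕ} (hd : d < n) (σ : Equiv.Perm (Fin n)) : SHS n d where
  helpers := fhsHelpers n d σ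
  card_helpers := card_fhsHelpers hd σ
  self_notMem := self_notMem_fhsHelpers hd σ

/-! ### Information flow graphs -/

/-- The storage nodes of an information flow graph after `T` repairs: the `n` initial nodes and the
newcomers of the times `0, …, T - 1`. -/
inductive StorageNode (n T : ℕ) where
  | initial (i : Fin n)
  | newcomer (τ : Fin T)
  deriving DecidableEq, Fintype

/-- The physical node that a storage node represents, for the failure pattern `F`. -/
def StorageNode.label {n T : ℕ} (F : Fin T → Fin n) : StorageNode n T → Fin n
  | initial i => i
  | newcomer τ => F τ

/-- The number of repairs that have been completed when a storage node comes into being. -/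
def StorageNode.birth {n T : ℕ} : StorageNode n T → ℕ
  | initial _ => 0
  | newcomer τ => (τ : ℕ) + 1

/-- `x` is active once the repairs of the times `0, …, t - 1` are completed: it exists by then, and
its physical node has not failed since `x` came into being. -/
def StorageNode.IsActive {n T : ℕ} (F : Fin T → Fin n) (t : ℕ) (x : StorageNode n T) : Prop :=
  x.birth ≤ t ∧ ∀ τ : Fin T, x.birth ≤ (τ : ℕ) → (τ : ℕ) < t → F τ ≠ x.label F

/-- The vertices of an information flow graph: the source, the two vertices of each storage node,
and one data collector for each choice of `k` of the `n` physical nodes. -/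
inductive IFGVertex (n k T : ℕ) where
  | source
  | inp (x : StorageNode n T)
  | out (x : StorageNode n T)
  | collector (K : {K : Finset (Fin n) // K.card = k})
  deriving DecidableEq, Fintype

open Classical in
/-- The edge capacities (`0` where there is no edge) of the information flow graph that the helper
selection scheme `A` generates from the failure pattern `F` of length `T`. -/
noncomputable def ifgCapacity {n d T : ℕ} (A : DHS n d) (k : ℕ) (α β : ℝ≥0) (F : Fin T → Fin n) :
    IFGVertex n k T → IFGVertex n k T → ℝ≥0∞
  | .source, .inp (.initial _) => ⊤
  | .inp x, .out y => if x = y then (α : ℝ≥0∞) else 0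
  | .out x, .inp (.newcomer τ) =>
      if x.IsActive F τ ∧ x.label F ∈ A.helpers τ (fun l => F (Fin.castLE τ.isLt l))
      then (β : ℝ≥0∞) else 0
  | .out x, .collector K => if x.IsActive F T ∧ x.label F ∈ K.1 then ⊤ else 0
  | _, _ => 0

/-- The minimum value of a cut `(U, Uᶜ)` with `s ∈ U` and `t ∈ Uᶜ` in a finite network with
capacities `c`. -/
noncomputable def minCut {V : Type*} [Fintype V] [DecidableEq V] (c : V → V → ℝ≥0∞) (s t : V) :
    ℝ≥0∞ :=
  ⨅ U : {U : Finset V // s ∈ U ∧ t ∉ U}, ∑ u ∈ U.1, ∑ v ∈ U.1ᶜ, c u v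

/-- The min-cut values between the source and the data collectors, over all information flow graphs
generated by the scheme `A` and all data collectors in them. -/
def minCutValues {n d : ℕ} (A : DHS n d) (k : ℕ) (α β : ℝ≥0) : Set ℝ≥0∞ :=
  {m | ∃ (T : ℕ) (F : Fin T → Fin n) (K : {K : Finset (Fin n) // K.card = k}),
    m = minCut (ifgCapacity A k α β F) IFGVertex.source (IFGVertex.collector K)}

/-! ### Storage nodes -/

/-! Both bounds count helper pairs, in units of `β`.

Upper bound, any scheme: cut off the storage nodes active at the end. An initial one costs at most
`α = dβ`, a newcomer at most `β` per helper that has failed since its repair. The cut is thus at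
most `(nd - s)β`, where `s` counts the saved pairs, that is, the helper edges between storage nodes
still active. If `2s < nd`, some node lies in fewer than `d` saved pairs; letting it fail destroys
only these and creates `d` new ones (`exists_card_savedPairs_lt`). So some pattern reaches `s ≥
nd/2`.

Lower bound, symmetric stationary scheme: take a finite cut. Since `k = n - 1`, of any two nodes at
least one has a storage node on the sink side. For a helper pair `{i, j}`, let `x` be the
earliest-born sink-side storage node representing `i` or `j`. If `x` is a newcomer, its helper
representing the other node is older, hence on the source side. So either that helper edge into `x`
is cut, or the inner edge of `x` is, and its capacity `dβ` pays for all `d` helpers. By symmetry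
there are `nd/2` such pairs (`sum_card_chargedHelpers_le`,
`mul_le_two_mul_sum_card_chargedHelpers`). FHS without an incomplete family is symmetric.

Minima are attained because every min-cut is infinite or a natural multiple of `β`. -/

/-- At every time each physical node is represented by an active storage node. -/
theorem StorageNode.exists_isActive {n T : ℕ} (F : Fin T → Fin n) (t : ℕ) (i : Fin n) :
    ∃ x : StorageNode n T, x.IsActive F t ∧ x.label F = i := by
  classical
  by_cases h : ∃ τ : Fin T, (τ : ℕ) < t ∧ F τ = i
  · obtain ⟨τ, hτ, hmax⟩ := Finset.exists_max_image
      (Finset.univ.filter fun τ : Fin T => (τ : ℕ) < t ∧ F τ = i) (fun τ => (τ : ℕ))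
      (by obtain ⟨τ, hτ⟩ := h; exact ⟨τ, by simpa using hτ⟩)
    simp only [Finset.mem_filter, Finset.mem_univ, true_and] at hτ hmax
    refine ⟨.newcomer τ, ⟨hτ.1, fun σ h1 h2 h3 => ?_⟩, hτ.2⟩
    have := hmax σ ⟨h2, h3.trans hτ.2⟩
    simp only [StorageNode.birth] at h1
    omega
  · push Not at h
    exact ⟨.initial i, ⟨Nat.zero_le _, fun σ _ h2 => h σ h2⟩, rfl⟩

/-- At every time each physical node is represented by at most one active storage node. -/
theorem StorageNode.IsActive.eq_of_label_eq {n T : ℕ} {F : Fin T → Fin n} {t : ℕ}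
    {x y : StorageNode n T} (hx : x.IsActive F t) (hy : y.IsActive F t)
    (h : x.label F = y.label F) : x = y := by
  rcases x with i | σ <;> rcases y with j | τ
  · exact congrArg _ h
  · exact absurd h.symm (hx.2 τ (Nat.zero_le _) hy.1)
  · exact absurd h (hy.2 σ (Nat.zero_le _) hx.1)
  · rcases lt_trichotomy σ τ with hlt | rfl | hlt
    · exact absurd h.symm (hx.2 τ hlt hy.1)
    · rfl
    · exact absurd h (hy.2 σ hlt hx.1)

/-! ### Cuts -/

/-- The capacity of the cut `(U, Uᶜ)`. -/
noncomputable def cutCapacity {V : Type*} [Fintype V] [DecidableEq V] (c : V → V → ℝ≥0∞)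
    (U : Finset V) : ℝ≥0∞ :=
  ∑ u ∈ U, ∑ v ∈ Uᶜ, c u v

theorem minCut_le_cutCapacity {V : Type*} [Fintype V] [DecidableEq V] (c : V → V → ℝ≥0∞)
    {s t : V} {U : Finset V} (hs : s ∈ U) (ht : t ∉ U) : minCut c s t ≤ cutCapacity c U :=
  iInf_le (fun U : {U : Finset V // s ∈ U ∧ t ∉ U} => ∑ u ∈ U.1, ∑ v ∈ U.1ᶜ, c u v) ⟨U, hs, ht⟩

theorem exists_minCut_eq_cutCapacity {V : Type*} [Fintype V] [DecidableEq V] (c : V → V → ℝ≥0∞)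
    {s t : V} (hst : s ≠ t) : ∃ U : Finset V, s ∈ U ∧ t ∉ U ∧ minCut c s t = cutCapacity c U := by
  have : Nonempty {U : Finset V // s ∈ U ∧ t ∉ U} :=
    ⟨⟨{s}, by simp, by simpa using hst.symm⟩⟩
  obtain ⟨U, hU⟩ := exists_eq_ciInf_of_finite
    (f := fun U : {U : Finset V // s ∈ U ∧ t ∉ U} => ∑ u ∈ U.1, ∑ v ∈ U.1ᶜ, c u v)
  exact ⟨U.1, U.2.1, U.2.2, hU.symm⟩

/-- Both bounds distribute the capacity over the heads of the cut edges, on the sink side. -/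
theorem cutCapacity_eq_sum_compl {V : Type*} [Fintype V] [DecidableEq V] (c : V → V → ℝ≥0∞)
    (U : Finset V) : cutCapacity c U = ∑ v ∈ Uᶜ, ∑ u ∈ U, c u v :=
  Finset.sum_comm

theorem le_cutCapacity {V : Type*} [Fintype V] [DecidableEq V] (c : V → V → ℝ≥0∞)
    {U : Finset V} {u v : V} (hu : u ∈ U) (hv : v ∉ U) : c u v ≤ cutCapacity c U :=
  (Finset.single_le_sum (f := fun v => c u v) (fun _ _ => zero_le) (by simpa using hv)).trans
    (Finset.single_le_sum (f := fun u => ∑ v ∈ Uᶜ, c u v) (fun _ _ => zero_le) hu)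

/-- When all finite capacities are multiples of `β`, so are all finite minimum cuts. -/
theorem minCut_eq_top_or_nsmul {V : Type*} [Fintype V] [DecidableEq V] (c : V → V → ℝ≥0∞)
    {s t : V} (hst : s ≠ t) (β : ℝ≥0∞) (hc : ∀ u v, c u v = ⊤ ∨ ∃ m : ℕ, c u v = m * β) :
    minCut c s t = ⊤ ∨ ∃ m : ℕ, minCut c s t = m * β := by
  obtain ⟨U, -, -, hU⟩ := exists_minCut_eq_cutCapacity c hst
  rw [hU]
  have hadd : ∀ a b : ℝ≥0∞, (a = ⊤ ∨ ∃ m : ℕ, a = m * β) → (b = ⊤ ∨ ∃ m : ℕ, b = m * β) →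
      (a + b = ⊤ ∨ ∃ m : ℕ, a + b = m * β) := by
    rintro a b (rfl | ⟨m, rfl⟩) (rfl | ⟨l, rfl⟩)
    · simp
    · simp
    · simp
    · exact Or.inr ⟨m + l, by push_cast; ring⟩
  have hzero : ((0 : ℝ≥0∞) = ⊤ ∨ ∃ m : ℕ, (0 : ℝ≥0∞) = m * β) := Or.inr ⟨0, by simp⟩
  exact Finset.sum_induction _ (fun a => a = ⊤ ∨ ∃ m : ℕ, a = m * β) hadd hzero fun u _ =>
    Finset.sum_induction _ (fun a => a = ⊤ ∨ ∃ m : ℕ, a = m * β) hadd hzero fun v _ => hc u v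

theorem ifgCapacity_eq_top_or_nsmul {n d T : ℕ} (A : DHS n d) (k : ℕ) {α β : ℝ≥0}
    (hα : α = d * β) (F : Fin T → Fin n) (u v : IFGVertex n k T) :
    ifgCapacity A k α β F u v = ⊤ ∨ ∃ m : ℕ, ifgCapacity A k α β F u v = m * (β : ℝ≥0∞) := by
  have h0 : ∃ m : ℕ, (0 : ℝ≥0∞) = m * (β : ℝ≥0∞) := ⟨0, by simp⟩
  have h1 : ∃ m : ℕ, (β : ℝ≥0∞) = m * (β : ℝ≥0∞) := ⟨1, by simp⟩
  have h2 : ∃ m : ℕ, (α : ℝ≥0∞) = m * (β : ℝ≥0∞) := ⟨d, by simp [hα]⟩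
  unfold ifgCapacity
  split
  · exact Or.inl rfl
  · split_ifs
    exacts [Or.inr h2, Or.inr h0]
  · split_ifs
    exacts [Or.inr h1, Or.inr h0]
  · split_ifs
    exacts [Or.inl rfl, Or.inr h0]
  · exact Or.inr h0

/-- For `α = dβ`, a finite upper bound on some min-cut value implies that the least value is
attained. -/
theorem exists_isLeast_minCutValues {n d k : ℕ} (A : DHS n d) {α β : ℝ≥0} (hα : α = d * β)
    {v : ℝ≥0∞} (hv : v ∈ minCutValues A k α β) (htop : v ≠ ⊤) :
    ∃ m : ℝ≥0, IsLeast (minCutValues A k α β) m := by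
  classical
  have hall : ∀ w ∈ minCutValues A k α β, w = ⊤ ∨ ∃ m : ℕ, w = m * (β : ℝ≥0∞) := by
    rintro w ⟨T, F, K, rfl⟩
    exact minCut_eq_top_or_nsmul _ (by simp) _ (ifgCapacity_eq_top_or_nsmul A k hα F)
  have hex : ∃ m : ℕ, (m * (β : ℝ≥0∞)) ∈ minCutValues A k α β := by
    obtain h | ⟨m, h⟩ := hall v hv
    · exact absurd h htop
    · exact ⟨m, h ▸ hv⟩
  -- The set of values may be infinite; the least natural coefficient gives its minimum.
  refine ⟨Nat.find hex * β, by simpa using Nat.find_spec hex, fun w hw => ?_⟩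
  obtain rfl | ⟨m, rfl⟩ := hall w hw
  · exact le_top
  · push_cast
    gcongr
    exact Nat.find_min' hex hw

/-! ### The upper bound for dynamic schemes -/

open Classical in
/-- The pairs `(j, i)` such that, after the failures of the times `0, …, T - 1`, the current
newcomer representing `j` was helped by `i`, and `i` has not failed since. -/
noncomputable def savedPairs {n d : ℕ} (A : DHS n d) (F : ℕ → Fin n) (T : ℕ) :
    Finset (Fin n × Fin n) :=
  Finset.univ.filter fun p => ∃ τ < T, F τ = p.1 ∧ p.2 ∈ A.helpers τ (fun l => F l) ∧
    ∀ σ, τ < σ → σ < T → F σ ≠ p.1 ∧ F σ ≠ p.2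

theorem mem_savedPairs {n d : ℕ} {A : DHS n d} {F : ℕ → Fin n} {T : ℕ} {j i : Fin n} :
    (j, i) ∈ savedPairs A F T ↔ ∃ τ < T, F τ = j ∧ i ∈ A.helpers τ (fun l => F l) ∧
      ∀ σ, τ < σ → σ < T → F σ ≠ j ∧ F σ ≠ i := by
  simp [savedPairs]

/-- In a set of pairs with fewer than `n * d / 2` elements, some `j` occurs in fewer than `d`. -/
theorem exists_card_incident_lt {n d : ℕ} (R : Finset (Fin n × Fin n)) (h : 2 * R.card < n * d) :
    ∃ j, (R.filter fun p => p.1 = j ∨ p.2 = j).card < d := by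
  by_contra! hcon
  have h1 : n * d ≤ ∑ j : Fin n, (R.filter fun p => p.1 = j ∨ p.2 = j).card := by
    simpa using Finset.card_nsmul_le_sum Finset.univ _ d (fun j _ => hcon j)
  have h2 : ∑ j : Fin n, (R.filter fun p => p.1 = j ∨ p.2 = j).card ≤ 2 * R.card := by
    calc _ ≤ ∑ j : Fin n, ((R.filter fun p => p.1 = j).card + (R.filter fun p => p.2 = j).card) :=
          Finset.sum_le_sum fun j _ => by
            rw [Finset.filter_or]; exact Finset.card_union_le _ _
      _ = 2 * R.card := by
          rw [Finset.sum_add_distrib, two_mul,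
            ← Finset.card_eq_sum_card_fiberwise (f := Prod.fst) (by simp),
            ← Finset.card_eq_sum_card_fiberwise (f := Prod.snd) (by simp)]
  omega

/-- As long as there are fewer than `n * d / 2` saved pairs, some next failure increases their
number. -/
theorem exists_card_savedPairs_lt {n d : ℕ} (A : DHS n d) (F : ℕ → Fin n) (T : ℕ)
    (h : 2 * (savedPairs A F T).card < n * d) :
    ∃ F' : ℕ → Fin n, (savedPairs A F T).card < (savedPairs A F' (T + 1)).card := by
  classical
  obtain ⟨j, hj⟩ := exists_card_incident_lt _ h
  set R := savedPairs A F T with hR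
  set F' := Function.update F T j with hF'
  have hT : F' T = j := by simp [hF']
  have hlt : ∀ σ, σ < T → F' σ = F σ := fun σ hσ => by simp [hF', hσ.ne]
  set H := A.helpers T (fun l => F' l) with hH
  -- Only pairs incident to `j` are lost when `j` fails, and its `d` new helper pairs are gained.
  have hsub : (R.filter fun p => ¬ (p.1 = j ∨ p.2 = j)) ∪ H.image (fun i => (j, i)) ⊆
      savedPairs A F' (T + 1) := by
    rintro ⟨a, b⟩ hp
    rw [mem_savedPairs]
    simp only [Finset.mem_union, Finset.mem_filter, Finset.mem_image, hR, mem_savedPairs,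
      not_or] at hp
    obtain ⟨⟨τ, hτ, h1, h2, h3⟩, ha, hb⟩ | ⟨i, hi, he⟩ := hp
    · refine ⟨τ, by omega, (hlt τ hτ).trans h1, ?_, fun σ hσ hσ' => ?_⟩
      · have : (fun l : Fin (τ + 1) => F' l) = fun l : Fin (τ + 1) => F l := by
          funext l
          exact hlt _ (by omega)
        rwa [this]
      · rcases Nat.lt_succ_iff_lt_or_eq.mp hσ' with hs | rfl
        · rw [hlt σ hs]; exact h3 σ hσ hs
        · rw [hT]; exact ⟨Ne.symm ha, Ne.symm hb⟩
    · obtain ⟨rfl, rfl⟩ := Prod.mk.inj he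
      exact ⟨T, by omega, hT, hi, fun σ h1 h2 => by omega⟩
  have hdisj : Disjoint (R.filter fun p => ¬ (p.1 = j ∨ p.2 = j)) (H.image (fun i => (j, i))) := by
    rw [Finset.disjoint_left]
    rintro ⟨a, b⟩ h1 h2
    simp only [Finset.mem_filter, Finset.mem_image, not_or] at h1 h2
    obtain ⟨i, -, he⟩ := h2
    exact h1.2.1 (Prod.mk.inj he).1.symm
  have hcard := Finset.card_le_card hsub
  rw [Finset.card_union_of_disjoint hdisj,
    Finset.card_image_of_injective _ (fun _ _ he => (Prod.mk.inj he).2), A.card_helpers] at hcard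
  have := Finset.card_filter_add_card_filter_not (s := R) (fun p => p.1 = j ∨ p.2 = j)
  exact ⟨F', by omega⟩

/-- Otherwise the greedy step could be repeated forever, pushing the count up to `n * d`. -/
theorem exists_le_two_mul_card_savedPairs {n d : ℕ} (hn : 0 < n) (A : DHS n d) :
    ∃ (F : ℕ → Fin n) (T : ℕ), n * d ≤ 2 * (savedPairs A F T).card := by
  by_contra! hcon
  have : ∀ m : ℕ, ∃ (F : ℕ → Fin n) (T : ℕ), m ≤ (savedPairs A F T).card := by
    intro m
    induction m with
    | zero => exact ⟨fun _ => ⟨0, hn⟩, 0, Nat.zero_le _⟩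
    | succ m ih =>
      obtain ⟨F, T, h⟩ := ih
      obtain ⟨F', h'⟩ := exists_card_savedPairs_lt A F T (hcon F T)
      exact ⟨F', T + 1, by omega⟩
  obtain ⟨F, T, h⟩ := this (n * d)
  have := hcon F T
  omega

open Classical in
/-- The sink side of the cut that separates the source from the storage nodes active at the end;
an initial node is cut at its capacity edge, a newcomer at its helper edges. -/
noncomputable def currentSide {n T : ℕ} (k : ℕ) (F : Fin T → Fin n) : Finset (IFGVertex n k T) :=
  Finset.univ.filter fun v => match v with
    | .source => False
    | .inp (.initial _) => False
    | .inp x => x.IsActive F T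
    | .out x => x.IsActive F T
    | .collector _ => True

/-- The number of helpers of a newcomer that fail after its repair. -/
theorem card_lost_helpers_le {n d : ℕ} (A : DHS n d) (F : ℕ → Fin n) (T : ℕ) (τ : Fin T)
    (hτ : (StorageNode.newcomer τ : StorageNode n T).IsActive (fun l : Fin T => F l) T)
    (S : Finset (StorageNode n T))
    (hS : ∀ x ∈ S, ¬ x.IsActive (fun l : Fin T => F l) T ∧ x.IsActive (fun l : Fin T => F l) τ ∧
      x.label (fun l : Fin T => F l) ∈ A.helpers τ (fun l => F l)) :
    S.card + ((savedPairs A F T).filter fun p => p.1 = F τ).card ≤ d := by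
  classical
  set H := A.helpers τ (fun l => F l) with hH
  have hself : F τ ∉ H := A.failed_notMem τ (fun l => F l)
  have hlast : ∀ σ, σ < T → F σ = F τ → σ ≤ τ := by
    intro σ hσ he
    by_contra! hlt
    exact hτ.2 ⟨σ, hσ⟩ hlt hσ he
  have h1 : S.card = (S.image (StorageNode.label fun l : Fin T => F l)).card :=
    (Finset.card_image_of_injOn fun x hx y hy h =>
      (hS x hx).2.1.eq_of_label_eq (hS y hy).2.1 h).symm
  have h2 : ((savedPairs A F T).filter fun p => p.1 = F τ).card =
      (((savedPairs A F T).filter fun p => p.1 = F τ).image Prod.snd).card := by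
    refine (Finset.card_image_of_injOn ?_).symm
    rintro ⟨a, b⟩ hx ⟨a', b'⟩ hy h
    simp only [Finset.coe_filter, Set.mem_ofPred_eq] at hx hy
    exact Prod.ext (hx.2.trans hy.2.symm) h
  have hsaved : ∀ i, (F τ, i) ∈ savedPairs A F T →
      i ∈ H ∧ ∀ σ, (τ : ℕ) < σ → σ < T → F σ ≠ i := by
    intro i hi
    rw [mem_savedPairs] at hi
    obtain ⟨σ, hσ, he, hi, hsurv⟩ := hi
    have hle := hlast σ hσ he
    -- A witness earlier than `τ` would be destroyed by the failure at `τ` itself.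
    have hge : (τ : ℕ) ≤ σ := by
      by_contra! hlt
      exact (hsurv τ hlt τ.isLt).1 rfl
    obtain rfl : σ = τ := le_antisymm hle hge
    exact ⟨hi, fun ρ h1 h2 => (hsurv ρ h1 h2).2⟩
  -- The lost and the surviving helpers are disjoint parts of the `d`-element set `H`.
  rw [h1, h2, ← Finset.card_union_of_disjoint]
  · refine (Finset.card_le_card ?_).trans_eq (A.card_helpers τ (fun l => F l))
    intro i hi
    rw [Finset.mem_union, Finset.mem_image, Finset.mem_image] at hi
    obtain ⟨x, hx, rfl⟩ | ⟨⟨a, b⟩, hp, rfl⟩ := hi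
    · exact (hS x hx).2.2
    · rw [Finset.mem_filter] at hp
      obtain ⟨hp, rfl⟩ := hp
      exact (hsaved b hp).1
  · rw [Finset.disjoint_left]
    intro i hi hi'
    rw [Finset.mem_image] at hi hi'
    obtain ⟨x, hx, rfl⟩ := hi
    obtain ⟨⟨a, b⟩, hp, hb⟩ := hi'
    rw [Finset.mem_filter] at hp
    obtain ⟨hp, rfl⟩ := hp
    obtain ⟨hna, hact, hmem⟩ := hS x hx
    simp only at hb
    subst hb
    -- If its pair were saved, `x` would still be active: its node does not fail between its birth
    -- and `τ`, nor at `τ` (no node helps itself), nor later.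
    refine hna ⟨hact.1.trans τ.isLt.le, fun σ h1 h2 he => ?_⟩
    rcases lt_trichotomy (σ : ℕ) τ with h | h | h
    · exact hact.2 σ h1 h he
    · obtain rfl : σ = τ := Fin.ext h
      have hlab : F σ = x.label (fun l : Fin T => F l) := he
      exact hself (hlab ▸ hmem)
    · exact (hsaved _ hp).2 σ h σ.isLt he

/-- The entrance through which the cut at `currentSide` separates a storage node. -/
def StorageNode.entrance {n T : ℕ} (k : ℕ) : StorageNode n T → IFGVertex n k T
  | initial i => .out (.initial i)
  | newcomer τ => .inp (.newcomer τ)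

/-- The total flow over the cut into the entrance of a storage node active at the end. -/
theorem sum_capacity_entrance_le {n d : ℕ} (A : DHS n d) (k : ℕ) {α β : ℝ≥0} (hα : α = d * β)
    (F : ℕ → Fin n) (T : ℕ) (x : StorageNode n T) (hx : x.IsActive (fun l : Fin T => F l) T) :
    ∑ u ∈ (currentSide k (fun l : Fin T => F l))ᶜ,
        ifgCapacity A k α β (fun l : Fin T => F l) u (x.entrance k) ≤
      ((d - ((savedPairs A F T).filter
        fun p => p.1 = x.label (fun l : Fin T => F l)).card : ℕ) : ℝ≥0∞) * β := by
  classical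
  rcases x with i | τ
  · have hempty : ((savedPairs A F T).filter fun p =>
        p.1 = StorageNode.label (fun l : Fin T => F l) (.initial i)) = ∅ := by
      rw [Finset.filter_eq_empty_iff]
      rintro ⟨a, b⟩ hp rfl
      rw [mem_savedPairs] at hp
      obtain ⟨τ, hτ, h, -⟩ := hp
      exact hx.2 ⟨τ, hτ⟩ (Nat.zero_le _) hτ h
    rw [hempty, Finset.card_empty, Nat.sub_zero]
    calc _ ≤ ∑ u, ifgCapacity A k α β (fun l : Fin T => F l) u (.out (.initial i)) :=
          Finset.sum_le_sum_of_subset (Finset.subset_univ _)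
      _ = ifgCapacity A k α β (fun l : Fin T => F l) (.inp (.initial i)) (.out (.initial i)) := by
          refine Finset.sum_eq_single_of_mem _ (Finset.mem_univ _) ?_
          rintro (_ | y | y | y) - hne
          · rfl
          · have : y ≠ .initial i := fun h => hne (by rw [h])
            simp [ifgCapacity, this]
          · rfl
          · rfl
      _ ≤ d * β := by simp [ifgCapacity, hα]
  · set G : Fin T → Fin n := fun l : Fin T => F l with hG
    set S : Finset (StorageNode n T) := Finset.univ.filter fun y =>
      ¬ y.IsActive G T ∧ y.IsActive G τ ∧ y.label G ∈ A.helpers τ (fun l => F l) with hS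
    have hcard := card_lost_helpers_le A F T τ hx S (fun y hy => by simpa [hS] using hy)
    calc _ ≤ ∑ u ∈ S.image IFGVertex.out,
          ifgCapacity A k α β G u (StorageNode.entrance k (.newcomer τ)) := by
          refine Finset.sum_le_sum_of_ne_zero ?_
          rintro (_ | y | y | y) hu hne
          · exact absurd rfl hne
          · exact absurd rfl hne
          · simp only [StorageNode.entrance, ifgCapacity, ne_eq, ite_eq_right_iff,
              Classical.not_imp] at hne
            refine Finset.mem_image_of_mem _ ?_
            rw [hS, Finset.mem_filter]
            refine ⟨Finset.mem_univ _, ?_, hne.1⟩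
            simpa [currentSide] using hu
          · exact absurd rfl hne
      _ ≤ (S.image (IFGVertex.out (k := k))).card • (β : ℝ≥0∞) := by
          refine Finset.sum_le_card_nsmul _ _ _ ?_
          intro u hu
          obtain ⟨y, -, rfl⟩ := Finset.mem_image.mp hu
          simp only [StorageNode.entrance, ifgCapacity]
          split_ifs
          · exact le_rfl
          · exact zero_le
      _ ≤ _ := by
          rw [nsmul_eq_mul]
          gcongr
          refine Finset.card_image_le.trans ?_
          have : (StorageNode.newcomer τ : StorageNode n T).label G = F τ := rfl
          rw [this]
          omega

theorem cutCapacity_currentSide_le {n d : ℕ} (A : DHS n d) (k : ℕ) {α β : ℝ≥0} (hα : α = d * β)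
    (F : ℕ → Fin n) (T : ℕ) :
    cutCapacity (ifgCapacity A k α β (fun l : Fin T => F l))
        (currentSide k (fun l : Fin T => F l))ᶜ ≤
      ((∑ i : Fin n, (d - ((savedPairs A F T).filter fun p => p.1 = i).card) : ℕ) : ℝ≥0∞) * β := by
  classical
  set G : Fin T → Fin n := fun l : Fin T => F l with hG
  choose x hx hlab using StorageNode.exists_isActive G T
  rw [cutCapacity_eq_sum_compl, compl_compl]
  calc _ ≤ ∑ v ∈ Finset.univ.image (fun i => (x i).entrance k),
        ∑ u ∈ (currentSide k G)ᶜ, ifgCapacity A k α β G u v := by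
        refine Finset.sum_le_sum_of_ne_zero ?_
        intro v hv hne
        -- All other sink-side vertices have their in-edges of nonzero capacity within the sink
        -- side.
        have hkey : ∃ y : StorageNode n T, y.IsActive G T ∧ y.entrance k = v := by
          obtain ⟨u, hu, hne⟩ := Finset.exists_ne_zero_of_sum_ne_zero hne
          rcases v with _ | ⟨i | τ⟩ | ⟨i | τ⟩ | K
          · simp [currentSide] at hv
          · simp [currentSide] at hv
          · exact ⟨.newcomer τ, by simpa [currentSide] using hv, rfl⟩
          · exact ⟨.initial i, by simpa [currentSide] using hv, rfl⟩
          · rcases u with _ | y | y | y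
            · exact absurd rfl hne
            · simp only [ifgCapacity, ne_eq, ite_eq_right_iff, Classical.not_imp] at hne
              obtain ⟨rfl, -⟩ := hne
              simp [currentSide] at hu hv
              exact absurd hv hu
            · exact absurd rfl hne
            · exact absurd rfl hne
          · rcases u with _ | y | y | y
            · exact absurd rfl hne
            · exact absurd rfl hne
            · simp only [ifgCapacity, ne_eq, ite_eq_right_iff, Classical.not_imp] at hne
              simp [currentSide] at hu
              exact absurd hne.1.1 hu
            · exact absurd rfl hne
        obtain ⟨y, hy, rfl⟩ := hkey
        rw [(hy.eq_of_label_eq (hx (y.label G)) (hlab _).symm)]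
        exact Finset.mem_image_of_mem _ (Finset.mem_univ _)
    _ ≤ ∑ i, ∑ u ∈ (currentSide k G)ᶜ, ifgCapacity A k α β G u ((x i).entrance k) :=
        Finset.sum_image_le_of_nonneg (fun _ _ => zero_le)
    _ ≤ ∑ i : Fin n, ((d - ((savedPairs A F T).filter fun p => p.1 = i).card : ℕ) : ℝ≥0∞) * β := by
        refine Finset.sum_le_sum fun i _ => ?_
        have := sum_capacity_entrance_le A k hα F T (x i) (hx i)
        rwa [hlab i] at this
    _ = _ := by rw [Nat.cast_sum, Finset.sum_mul]

theorem card_filter_savedPairs_le {n d : ℕ} (A : DHS n d) (F : ℕ → Fin n) (T : ℕ) (i : Fin n) :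
    ((savedPairs A F T).filter fun p => p.1 = i).card ≤ d := by
  obtain ⟨x, hx, hlab⟩ := StorageNode.exists_isActive (fun l : Fin T => F l) T i
  rcases x with j | τ
  · obtain rfl : j = i := hlab
    rw [Finset.filter_eq_empty_iff.mpr, Finset.card_empty]
    · exact Nat.zero_le _
    · rintro ⟨a, b⟩ hp rfl
      obtain ⟨τ, hτ, h, -⟩ := mem_savedPairs.mp hp
      exact hx.2 ⟨τ, hτ⟩ (Nat.zero_le _) hτ h
  · obtain rfl : F τ = i := hlab
    simpa using card_lost_helpers_le A F T τ hx ∅ (by simp)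

/-- Every dynamic scheme with `α = dβ` has a min-cut value of at most `nα/2`. -/
theorem exists_mem_minCutValues_le {n d k : ℕ} (hn : 0 < n) (hk : k ≤ n) (A : DHS n d)
    {α β : ℝ≥0} (hα : α = d * β) :
    ∃ v ∈ minCutValues A k α β, v ≤ (n : ℝ≥0∞) * α / 2 := by
  classical
  obtain ⟨F, T, hFT⟩ := exists_le_two_mul_card_savedPairs hn A
  -- Any collector will do, as `currentSide` contains all active storage nodes.
  obtain ⟨K, -, hK⟩ := Finset.exists_subset_card_eq
    (s := (Finset.univ : Finset (Fin n))) (n := k) (by simpa using hk)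
  refine ⟨_, ⟨T, fun l => F l, ⟨K, hK⟩, rfl⟩, ?_⟩
  refine (minCut_le_cutCapacity _ (U := (currentSide k (fun l : Fin T => F l))ᶜ)
    (by simp [currentSide]) (by simp [currentSide])).trans ?_
  refine (cutCapacity_currentSide_le A k hα F T).trans ?_
  -- The truncated subtraction is exact, since no node has more than `d` saved helpers.
  have hsum : (∑ i : Fin n, (d - ((savedPairs A F T).filter fun p => p.1 = i).card)) +
      (savedPairs A F T).card = n * d := by
    rw [Finset.card_eq_sum_card_fiberwise (f := Prod.fst) (t := Finset.univ) (by simp),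
      ← Finset.sum_add_distrib,
      Finset.sum_congr rfl fun i _ => Nat.sub_add_cancel (card_filter_savedPairs_le A F T i)]
    simp
  rw [ENNReal.le_div_iff_mul_le (by simp) (by simp), hα]
  push_cast [-Nat.cast_sum]
  rw [← mul_assoc, mul_right_comm]
  gcongr ?_ * (β : ℝ≥0∞)
  norm_cast
  omega

/-! ### The lower bound for symmetric stationary schemes -/

open Classical in
/-- The helpers of the storage node `x` whose version at the repair of `x` lies on the source side
`U` of a cut; for an initial node, all helpers. -/
noncomputable def chargedHelpers {n d k T : ℕ} (A : SHS n d) (F : Fin T → Fin n)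
    (U : Finset (IFGVertex n k T)) (x : StorageNode n T) : Finset (Fin n) :=
  (A.helpers (x.label F)).filter fun j => ∀ τ, x = .newcomer τ →
    ∀ y : StorageNode n T, y.IsActive F τ → y.label F = j → IFGVertex.out y ∈ U

/-- Charging a cut to the storage nodes on its sink side. -/
theorem sum_card_chargedHelpers_le {n d k T : ℕ} (A : SHS n d) {α β : ℝ≥0} (hα : α = d * β)
    (F : Fin T → Fin n) (U : Finset (IFGVertex n k T)) (hs : IFGVertex.source ∈ U)
    (htop : cutCapacity (ifgCapacity A.toDHS k α β F) U ≠ ⊤) :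
    ((∑ x : StorageNode n T with IFGVertex.out x ∉ U, (chargedHelpers A F U x).card : ℕ) : ℝ≥0∞)
        * β ≤ cutCapacity (ifgCapacity A.toDHS k α β F) U := by
  classical
  set W := Finset.univ.filter fun x : StorageNode n T => IFGVertex.out x ∉ U with hW
  set c := ifgCapacity A.toDHS k α β F with hc
  -- The vertex at which the cut enters `x`; injectivity keeps the charges of different storage
  -- nodes apart.
  set e : StorageNode n T → IFGVertex n k T :=
    fun x => if IFGVertex.inp x ∈ U then .out x else .inp x with he
  have hinj : Function.Injective e := by
    intro x y hxy
    simp only [he] at hxy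
    split_ifs at hxy <;> simpa using hxy
  rw [cutCapacity_eq_sum_compl]
  calc _ = ∑ x ∈ W, ((chargedHelpers A F U x).card : ℝ≥0∞) * β := by
        rw [Nat.cast_sum, Finset.sum_mul]
    _ ≤ ∑ x ∈ W, ∑ u ∈ U, c u (e x) := by
        refine Finset.sum_le_sum fun x hx => ?_
        by_cases hxU : IFGVertex.inp x ∈ U
        · calc _ ≤ (d : ℝ≥0∞) * β := by
                gcongr
                exact (Finset.card_filter_le _ _).trans (A.card_helpers _).le
            _ = c (.inp x) (e x) := by simp [he, hxU, hc, ifgCapacity, hα]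
            _ ≤ _ := Finset.single_le_sum (f := fun u => c u (e x)) (fun _ _ => zero_le) hxU
        -- An initial node with its in-vertex on the sink side would cut an infinite edge from the
        -- source.
        · rcases x with i | τ
          · refine absurd (top_le_iff.mp ?_) htop
            exact le_cutCapacity c hs hxU
          · choose y hy hlab using StorageNode.exists_isActive F (τ : ℕ)
            have hyinj : Function.Injective fun j => IFGVertex.out (k := k) (y j) := by
              intro i j hij
              rw [← hlab i, ← hlab j, IFGVertex.out.inj hij]
            calc _ = ∑ u ∈ (chargedHelpers A F U (.newcomer τ)).image
                    (fun j => IFGVertex.out (y j)), (β : ℝ≥0∞) := by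
                  rw [Finset.sum_const, Finset.card_image_of_injective _ hyinj, nsmul_eq_mul]
              _ = ∑ u ∈ (chargedHelpers A F U (.newcomer τ)).image
                    (fun j => IFGVertex.out (y j)), c u (e (.newcomer τ)) := by
                  refine Finset.sum_congr rfl fun u hu => ?_
                  obtain ⟨j, hj, rfl⟩ := Finset.mem_image.mp hu
                  rw [chargedHelpers, Finset.mem_filter] at hj
                  have hmem : (y j).label F ∈ A.toDHS.helpers τ
                      (fun l => F (Fin.castLE τ.isLt l)) := by
                    rw [hlab]; exact hj.1
                  simp only [he, hxU, if_false, hc, ifgCapacity]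
                  rw [if_pos ⟨hy j, hmem⟩]
              _ ≤ _ := by
                  refine Finset.sum_le_sum_of_subset ?_
                  intro u hu
                  obtain ⟨j, hj, rfl⟩ := Finset.mem_image.mp hu
                  rw [chargedHelpers, Finset.mem_filter] at hj
                  exact hj.2 τ rfl _ (hy j) (hlab j)
    _ = ∑ v ∈ W.image e, ∑ u ∈ U, c u v := by
        rw [Finset.sum_image fun x _ y _ h => hinj h]
    _ ≤ ∑ v ∈ Uᶜ, ∑ u ∈ U, c u v := by
        refine Finset.sum_le_sum_of_subset ?_
        intro v hv
        obtain ⟨x, hx, rfl⟩ := Finset.mem_image.mp hv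
        rw [hW, Finset.mem_filter] at hx
        rw [Finset.mem_compl]
        simp only [he]
        split_ifs with h
        exacts [hx.2, h]

/-- If the helper relation is symmetric, every helper pair is charged to a storage node on the sink
side of a finite cut. -/
theorem mul_le_two_mul_sum_card_chargedHelpers {n d k T : ℕ} (A : SHS n d)
    (hsymm : ∀ i j, j ∈ A.helpers i → i ∈ A.helpers j) (hk : k = n - 1)
    {α β : ℝ≥0} (F : Fin T → Fin n) (U : Finset (IFGVertex n k T))
    (K : {K : Finset (Fin n) // K.card = k}) (ht : IFGVertex.collector K ∉ U)
    (htop : cutCapacity (ifgCapacity A.toDHS k α β F) U ≠ ⊤) :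
    n * d ≤ 2 * ∑ x : StorageNode n T with IFGVertex.out x ∉ U,
      (chargedHelpers A F U x).card := by
  classical
  set W := Finset.univ.filter fun x : StorageNode n T => IFGVertex.out x ∉ U with hW
  have hKW : ∀ i ∈ K.1, ∃ x ∈ W, x.label F = i := by
    intro i hi
    obtain ⟨x, hx, hlab⟩ := StorageNode.exists_isActive F T i
    refine ⟨x, ?_, hlab⟩
    rw [hW, Finset.mem_filter]
    refine ⟨Finset.mem_univ _, fun hxU => htop (top_le_iff.mp ?_)⟩
    refine le_trans ?_ (le_cutCapacity _ hxU ht)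
    simp [ifgCapacity, hx, hlab, hi]
  set D := (Finset.univ : Finset (Fin n × Fin n)).filter fun p => p.2 ∈ A.helpers p.1 with hD
  set C := W.sup fun x => (chargedHelpers A F U x).image fun j => (x.label F, j) with hC
  have hCcard : C.card ≤ ∑ x ∈ W, (chargedHelpers A F U x).card := by
    rw [hC, Finset.sup_eq_biUnion]
    exact Finset.card_biUnion_le.trans (Finset.sum_le_sum fun x _ => Finset.card_image_le)
  have hDcard : D.card = n * d := by
    rw [hD, Finset.card_filter, Fintype.sum_prod_type]
    simp [A.card_helpers]
  have hmemK : ∀ i j : Fin n, i ≠ j → i ∈ K.1 ∨ j ∈ K.1 := by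
    intro i j hij
    by_contra! h
    have h1 : ({i, j} : Finset (Fin n)) ⊆ K.1ᶜ := by
      intro a ha
      simp only [Finset.mem_insert, Finset.mem_singleton] at ha
      rw [Finset.mem_compl]
      rcases ha with rfl | rfl
      exacts [h.1, h.2]
    have h2 := Finset.card_le_card h1
    rw [Finset.card_pair hij, Finset.card_compl, Fintype.card_fin, K.2] at h2
    omega
  -- Each ordered helper pair is charged in one of its two orientations; this is the source of the
  -- factor 2.
  have hsub : D ⊆ C ∪ C.image Prod.swap := by
    rintro ⟨i, j⟩ hij
    replace hij : j ∈ A.helpers i := by simpa [hD] using hij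
    have hne : i ≠ j := by
      rintro rfl
      exact A.self_notMem _ hij
    obtain ⟨x, hx, hmin⟩ := Finset.exists_min_image
      (W.filter fun x => x.label F = i ∨ x.label F = j) StorageNode.birth (by
        rcases hmemK i j hne with h | h
        · obtain ⟨x, hx, hl⟩ := hKW i h
          exact ⟨x, by rw [Finset.mem_filter]; exact ⟨hx, Or.inl hl⟩⟩
        · obtain ⟨x, hx, hl⟩ := hKW j h
          exact ⟨x, by rw [Finset.mem_filter]; exact ⟨hx, Or.inr hl⟩⟩)
    rw [Finset.mem_filter] at hx
    have hcharge : ∀ a b, b ∈ A.helpers a → (b = i ∨ b = j) → x.label F = a → (a, b) ∈ C := by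
      rintro a b hab hb rfl
      rw [hC, Finset.sup_eq_biUnion, Finset.mem_biUnion]
      refine ⟨x, hx.1, Finset.mem_image_of_mem _ ?_⟩
      rw [chargedHelpers, Finset.mem_filter]
      refine ⟨hab, ?_⟩
      rintro τ rfl y hy rfl
      -- A helper `y` active at time `τ` has birth at most `τ`, whereas `x` has birth `τ + 1`; on
      -- the sink side `y` would contradict the minimality of `x`.
      by_contra hyU
      have hle := hmin y (by
        rw [Finset.mem_filter, hW, Finset.mem_filter]
        exact ⟨⟨Finset.mem_univ _, hyU⟩, hb⟩)
      have := hy.1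
      simp only [StorageNode.birth] at hle this
      omega
    rw [Finset.mem_union, Finset.mem_image]
    rcases hx.2 with h | h
    · exact Or.inl (hcharge i j hij (Or.inr rfl) h)
    · exact Or.inr ⟨(j, i), hcharge j i (hsymm i j hij) (Or.inl rfl) h, rfl⟩
  have h1 := Finset.card_le_card hsub
  have h2 := Finset.card_union_le C (C.image Prod.swap)
  have h3 : (C.image Prod.swap).card ≤ C.card := Finset.card_image_le
  omega

/-- A stationary scheme with a symmetric helper relation has min-cut values of at least `nα/2`. -/
theorem le_of_mem_minCutValues {n d k : ℕ} (A : SHS n d)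
    (hsymm : ∀ i j, j ∈ A.helpers i → i ∈ A.helpers j) (hk : k = n - 1) {α β : ℝ≥0}
    (hα : α = d * β) {v : ℝ≥0∞} (hv : v ∈ minCutValues A.toDHS k α β) :
    (n : ℝ≥0∞) * α / 2 ≤ v := by
  obtain ⟨T, F, K, rfl⟩ := hv
  obtain ⟨U, hs, ht, hU⟩ := exists_minCut_eq_cutCapacity (ifgCapacity A.toDHS k α β F)
    (s := IFGVertex.source) (t := IFGVertex.collector K) (by simp)
  rw [hU]
  by_cases htop : cutCapacity (ifgCapacity A.toDHS k α β F) U = ⊤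
  · rw [htop]
    exact le_top
  refine le_trans ?_ (sum_card_chargedHelpers_le A hα F U hs htop)
  have h := mul_le_two_mul_sum_card_chargedHelpers A hsymm hk F U K ht htop
  refine ENNReal.div_le_of_le_mul ?_
  rw [hα, ENNReal.coe_mul, ENNReal.coe_natCast, ← mul_assoc, mul_right_comm _ _ 2]
  gcongr ?_ * (β : ℝ≥0∞)
  rw [mul_comm 2] at h
  exact_mod_cast h

/-- Without an incomplete family, the helper relation of the FHS scheme is symmetric. -/
theorem fhs_helpers_symm {n d : ℕ} (hdn : d < n) (hmod : n % (n - d) = 0)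
    (σ : Equiv.Perm (Fin n)) (i j : Fin n) (h : j ∈ (fhs hdn σ).helpers i) :
    i ∈ (fhs hdn σ).helpers j := by
  have hcomplete : ∀ i : Fin n, (σ i : ℕ) / (n - d) < n / (n - d) := fun i =>
    Nat.div_lt_div_of_lt_of_dvd (Nat.dvd_of_mod_eq_zero hmod) (σ i).isLt
  simp only [fhs, fhsHelpers, hcomplete, if_true, Finset.mem_filter, Finset.mem_univ,
    true_and] at h ⊢
  exact h.symm

theorem mainTheorem6 (n k d : ℕ) (hd : 1 ≤ d) (hdn : d < n) (hk : k = n - 1)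
    (hmod : n % (n - d) = 0) (α β : ℝ≥0) (hα : α = d * β) :
    (∀ σ : Equiv.Perm (Fin n),
      IsLeast (minCutValues (fhs hdn σ).toDHS k α β) ((n : ℝ≥0∞) * α / 2)) ∧
    ∀ A : DHS n d, ∃ m : ℝ≥0∞,
      IsLeast (minCutValues A k α β) m ∧ m ≤ (n : ℝ≥0∞) * α / 2 := by

  have hub : ∀ A : DHS n d, ∃ v ∈ minCutValues A k α β, v ≤ (n : ℝ≥0∞) * α / 2 := fun A =>
    exists_mem_minCutValues_le (by omega) (by omega) A hα
  refine ⟨fun σ => ?_, fun A => ?_⟩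
  · have hlb : (n : ℝ≥0∞) * α / 2 ∈ lowerBounds (minCutValues (fhs hdn σ).toDHS k α β) :=
      fun w hw => le_of_mem_minCutValues _ (fhs_helpers_symm hdn hmod σ) hk hα hw
    obtain ⟨v, hv, hle⟩ := hub (fhs hdn σ).toDHS
    -- The value supplied by the upper bound must equal the lower bound, hence is attained.
    exact ⟨le_antisymm hle (hlb hv) ▸ hv, hlb⟩
  · obtain ⟨v, hv, hle⟩ := hub A
    have htop : (n : ℝ≥0∞) * α / 2 < ⊤ :=
      ENNReal.div_lt_top (ENNReal.mul_ne_top (by simp) (by simp)) (by simp)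
    obtain ⟨m, hm⟩ := exists_isLeast_minCutValues A hα hv (hle.trans_lt htop).ne
    exact ⟨m, hm, (hm.2 hv).trans hle⟩
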